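/- Let $K$ be a compact line, i.e. a linearly ordered set that is compact in its order topology, and let $C(K)$ be the Banach space of continuous real-valued functions on $K$ with the supremum norm. Then $C(K)$ has the Sobczyk property: every isomorphic copy of $c_0$ in $C(K)$ is complemented. That is, if $Y$ is a linear subspace of $C(K)$ for which there is a linear homeomorphism from $c_0$ (the space of real sequences converging to $0$, with the supremum norm) onto $Y$, then there is a bounded linear operator $P:C(K)\to Y$ with $P(y)=y$ for all $y\in Y$. -/

import Mathlib

open scoped ZeroAtInfty

/-- A real normed space `X` has the Sobczyk property if every isomorphic copy of `c₀` in `X` is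
complemented: each linear subspace `Y` of `X` that is linearly homeomorphic to `c₀` is the range of
a bounded projection of `X`. Here `c₀` is `C₀(ℕ, ℝ)` with the supremum norm: `ℕ` is discrete, so
its elements are exactly the real sequences converging to `0`. Such a `Y` is automatically
complete, hence closed in `X`. -/
def HasSobczykProperty (X : Type*) [NormedAddCommGroup X] [NormedSpace ℝ X] : Prop :=
  ∀ Y : Submodule ℝ X, Nonempty (C₀(ℕ, ℝ) ≃L[ℝ] Y) → Y.ClosedComplemented

open Set Filter Topology

/-! Let `T` embed `c₀` in `C(K)` and put `yₘ = T eₘ`, so `∑ |yₘ x| ≤ ‖T‖` at each `x`. By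
Hahn–Banach the coordinates of the copy extend to functionals `μₙ` on `ℓ∞(K)`, uniformly bounded.
The aim is to correct them to `μₙ ∘ (id - Aₙ)`, where `Aₙ f → f` uniformly for each `f`, which
forces pointwise convergence to zero, while `μₙ (Aₙ (T a))` stays small. The resulting operator into
`c₀` nearly inverts `T`, and a Neumann series finishes.

`Aₙ` averages composition with `r` consecutive maps `π i : K → K`, which need not be continuous;
hence `ℓ∞(K)`. By `exists_scales`, `π i` barely changes `yₘ` for `m < N i`, and the rest sum at `π i
x` to hardly more than the block `[N i, N (i + 1))` does at `x`. Disjoint blocks total at most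
`‖T‖`, so averaging leaves an error of order `‖T‖ / r + 3 * ε`, and the main term involves only
indices `m < n`, where `μₙ` vanishes.

The order of `K` enters in building `π i`: a point goes to a nearest one, on one side, of a compact
set where the tail is nearly minimal, so it never crosses a point with small tail. Tails tend to
zero pointwise, so every point is eventually uncrossed, which gives uniform convergence. -/

/-- A point has a nearest point of a nonempty compact set on one of its two sides. -/
theorem IsCompact.exists_mem_forall_le {K : Type*} [LinearOrder K] [TopologicalSpace K]
    [OrderTopology K] {B : Set K} (hB : IsCompact B) (hne : B.Nonempty) (x : K) :
    ∃ z ∈ B, ∀ b ∈ B, (x ≤ b → z ≤ b) ∧ (b ≤ x → b ≤ z) := by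
  by_cases h : (B ∩ Iic x).Nonempty
  · obtain ⟨z, hz, hmax⟩ := (hB.inter_right isClosed_Iic).exists_isGreatest h
    exact ⟨z, hz.1, fun b hb => ⟨fun h => le_trans hz.2 h, fun h => hmax ⟨hb, h⟩⟩⟩
  · obtain ⟨z, hz, hmin⟩ := hB.exists_isLeast hne
    exact ⟨z, hz, fun b hb => ⟨fun _ => hmin hb, fun h' => absurd ⟨b, hb, h'⟩ h⟩⟩

/-! ### Tails of a pointwise absolutely summable sequence. -/

section AbsTail

variable {K : Type*} [TopologicalSpace K]

/-- The sum of the absolute values at `x` of all but the first `N` functions. -/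
noncomputable def absTail (y : ℕ → C(K, ℝ)) (N : ℕ) (x : K) : ℝ := ∑' m, |y (m + N) x|

variable {y : ℕ → C(K, ℝ)}

theorem absTail_nonneg (N : ℕ) (x : K) : 0 ≤ absTail y N x :=
  tsum_nonneg fun _ => abs_nonneg _

theorem summable_abs_add (hs : ∀ x, Summable fun m => |y m x|) (N : ℕ) (x : K) :
    Summable fun m => |y (m + N) x| :=
  (summable_nat_add_iff (f := fun m => |y m x|) N).2 (hs x)

theorem sum_range_le_absTail (hs : ∀ x, Summable fun m => |y m x|) (N k : ℕ) (x : K) :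
    ∑ m ∈ Finset.range k, |y (m + N) x| ≤ absTail y N x :=
  (summable_abs_add hs N x).sum_le_tsum _ fun _ _ => abs_nonneg _

/-- As a supremum of continuous partial sums, the tail is lower semicontinuous. -/
theorem isClosed_setOf_absTail_le (hs : ∀ x, Summable fun m => |y m x|) (N : ℕ) (c : ℝ) :
    IsClosed {x | absTail y N x ≤ c} := by
  have : {x | absTail y N x ≤ c} = ⋂ k, {x | ∑ m ∈ Finset.range k, |y (m + N) x| ≤ c} := by
    ext x
    simp only [mem_ofPred_eq, mem_iInter]
    exact ⟨fun h k => (sum_range_le_absTail hs N k x).trans h,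
      fun h => (summable_abs_add hs N x).tsum_le_of_sum_range_le h⟩
  rw [this]
  exact isClosed_iInter fun k => isClosed_le (by fun_prop) continuous_const

theorem tendsto_absTail (x : K) : Tendsto (fun N => absTail y N x) atTop (𝓝 0) :=
  tendsto_sum_nat_add fun m => |y m x|

/-- A strict lower bound for the tails on a compact set is attained by a finite part. -/
theorem exists_forall_lt_sum_range (hs : ∀ x, Summable fun m => |y m x|) {J : Set K}
    (hJ : IsCompact J) (N : ℕ) {c : ℝ} (hc : ∀ x ∈ J, c < absTail y N x) :
    ∃ k, ∀ x ∈ J, c < ∑ m ∈ Finset.range k, |y (m + N) x| := by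
  obtain ⟨k, hk⟩ := hJ.elim_directed_cover
    (fun k => {x | c < ∑ m ∈ Finset.range k, |y (m + N) x|})
    (fun k => isOpen_lt continuous_const (by fun_prop))
    (fun x hx => by
      have := (summable_abs_add hs N x).hasSum.tendsto_sum_nat.eventually_const_lt (hc x hx)
      obtain ⟨k, hk⟩ := this.exists
      exact mem_iUnion.2 ⟨k, hk⟩)
    (Monotone.directed_le fun a b hab => ofPred_subset_ofPred.2 fun x hx => hx.trans_le
      (Finset.sum_le_sum_of_subset_of_nonneg (Finset.range_mono hab) fun _ _ _ => abs_nonneg _))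
  exact ⟨k, fun x hx => hk hx⟩

end AbsTail

/-! ### Order-respecting maps on a compact line. -/

section CompactLine

variable {K : Type*} [LinearOrder K] [TopologicalSpace K] [OrderTopology K] [CompactSpace K]

/-- A continuous map on a compact line oscillates little on each interval of a finite cover. -/
theorem exists_finset_Icc_cover {E : Type*} [PseudoMetricSpace E] {h : K → E} (hh : Continuous h)
    {ε : ℝ} (hε : 0 < ε) :
    ∃ F : Finset (K × K), (∀ x, ∃ p ∈ F, x ∈ Icc p.1 p.2) ∧
      ∀ p ∈ F, ∀ u ∈ Icc p.1 p.2, ∀ v ∈ Icc p.1 p.2, dist (h u) (h v) ≤ ε := by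
  classical
  have key : ∀ x : K, ∃ p : K × K, Icc p.1 p.2 ∈ 𝓝 x ∧
      ∀ u ∈ Icc p.1 p.2, ∀ v ∈ Icc p.1 p.2, dist (h u) (h v) ≤ ε := by
    intro x
    have hU : h ⁻¹' Metric.ball (h x) (ε / 2) ∈ 𝓝 x :=
      hh.continuousAt.preimage_mem_nhds (Metric.ball_mem_nhds _ (half_pos hε))
    obtain ⟨b, c, -, hn, hsub⟩ := exists_Icc_mem_subset_of_mem_nhds hU
    refine ⟨(b, c), hn, fun u hu v hv => ?_⟩
    have h1 := Metric.mem_ball.1 (hsub hu)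
    have h2 := Metric.mem_ball.1 (hsub hv)
    linarith [dist_triangle_right (h u) (h v) (h x)]
  choose p hp hosc using key
  obtain ⟨t, -, ht⟩ := isCompact_univ.elim_nhds_subcover (fun x => Icc (p x).1 (p x).2)
    (fun x _ => hp x)
  refine ⟨t.image p, fun x => ?_, ?_⟩
  · obtain ⟨z, hz, hxz⟩ := mem_iUnion₂.1 (ht (mem_univ x))
    exact ⟨p z, Finset.mem_image_of_mem p hz, hxz⟩
  · intro q hq
    obtain ⟨z, -, rfl⟩ := Finset.mem_image.1 hq
    exact hosc z

/-- If self-maps of a compact line eventually preserve the order relations with each given point,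
then composition with them converges uniformly to the identity on continuous functions. -/
theorem eventually_forall_abs_comp_sub_le {ι : Type*} {l : Filter ι} {π : ι → K → K}
    (hπ : ∀ p, ∀ᶠ i in l, ∀ x, (x ≤ p → π i x ≤ p) ∧ (p ≤ x → p ≤ π i x))
    (f : C(K, ℝ)) {ε : ℝ} (hε : 0 < ε) : ∀ᶠ i in l, ∀ x, |f (π i x) - f x| ≤ ε := by
  obtain ⟨F, hF, hosc⟩ := exists_finset_Icc_cover f.continuous hε
  -- Once no endpoint is crossed, each interval of the cover is mapped into itself.
  have h1 : ∀ᶠ i in l, ∀ p ∈ F, ∀ x, (x ≤ p.2 → π i x ≤ p.2) ∧ (p.1 ≤ x → p.1 ≤ π i x) := by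
    refine (Filter.eventually_all_finset F).2 fun p _ => ?_
    filter_upwards [hπ p.1, hπ p.2] with i h1 h2 x
    exact ⟨(h2 x).1, (h1 x).2⟩
  filter_upwards [h1] with i hi x
  obtain ⟨p, hp, hx⟩ := hF x
  exact hosc p hp _ ⟨(hi p hp x).2 hx.1, (hi p hp x).1 hx.2⟩ x hx

variable {y : ℕ → C(K, ℝ)}

/-- Let `τ` be the infimum of the tail on the interval. By compactness one finite part exceeds `τ -
ε` throughout, while `z` is chosen with tail at most `τ + ε`; this accounts for `2 * ε`. -/
theorem exists_nearby_small_absTail_on_Icc (hs : ∀ x, Summable fun m => |y m x|) (a b : K) (N : ℕ)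
    {ε : ℝ} (hε : 0 < ε) :
    ∃ k, ∀ x ∈ Icc a b, ∃ z ∈ Icc a b,
      absTail y N z ≤ ∑ m ∈ Finset.range k, |y (m + N) x| + 2 * ε ∧
      ∀ p, absTail y N p ≤ ε → (x ≤ p → z ≤ p) ∧ (p ≤ x → p ≤ z) := by
  rcases (Icc a b).eq_empty_or_nonempty with he | hne
  · exact ⟨0, fun x hx => absurd hx (by simp [he])⟩
  have hJ : IsCompact (Icc a b) := isClosed_Icc.isCompact
  set τ := sInf (absTail y N '' Icc a b) with hτ
  have hbdd : BddBelow (absTail y N '' Icc a b) :=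
    ⟨0, by rintro _ ⟨x, -, rfl⟩; exact absTail_nonneg N x⟩
  have hτ0 : 0 ≤ τ := Real.sInf_nonneg (by rintro _ ⟨x, -, rfl⟩; exact absTail_nonneg N x)
  obtain ⟨k, hk⟩ := exists_forall_lt_sum_range hs hJ N (c := τ - ε)
    (fun x hx => (sub_lt_self τ hε).trans_le (csInf_le hbdd (mem_image_of_mem _ hx)))
  have hB : IsCompact (Icc a b ∩ {x | absTail y N x ≤ τ + ε}) :=
    hJ.inter_right (isClosed_setOf_absTail_le hs N _)
  have hBne : (Icc a b ∩ {x | absTail y N x ≤ τ + ε}).Nonempty := by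
    obtain ⟨_, ⟨z, hz, rfl⟩, hlt⟩ := exists_lt_of_csInf_lt (hne.image (absTail y N))
      (lt_add_of_pos_right τ hε)
    exact ⟨z, hz, hlt.le⟩
  refine ⟨k, fun x hx => ?_⟩
  obtain ⟨z, ⟨hzJ, hzt⟩, hz⟩ := hB.exists_mem_forall_le hBne x
  refine ⟨z, hzJ, ?_, fun p hp => ?_⟩
  · have := hk x hx
    have h2 : absTail y N z ≤ τ + ε := hzt
    linarith
  -- Since `0 ≤ τ`, a point `p` of the interval with tail at most `ε` lies in the compact set from
  -- which `z` was chosen. A point outside has `x` and `z` on the same side.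
  · by_cases hpJ : p ∈ Icc a b
    · exact hz p ⟨hpJ, by simp only [mem_ofPred_eq]; linarith⟩
    · refine ⟨fun h => ?_, fun h => ?_⟩
      · have : b < p := by
          by_contra hb
          exact hpJ ⟨hx.1.trans h, not_lt.1 hb⟩
        exact hzJ.2.trans this.le
      · have : p < a := by
          by_contra hb
          exact hpJ ⟨not_lt.1 hb, h.trans hx.2⟩
        exact this.le.trans hzJ.1

/-- Each point can be moved to a nearby one at which the first `N` functions are almost unchanged
and the remaining ones contribute hardly more than a fixed finite part of them did before. -/
theorem exists_map_small_absTail (hs : ∀ x, Summable fun m => |y m x|) (N : ℕ) {ε : ℝ}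
    (hε : 0 < ε) :
    ∃ k, ∃ π : K → K, ∀ x,
      absTail y N (π x) ≤ ∑ m ∈ Finset.range k, |y (m + N) x| + 2 * ε ∧
      ∑ m ∈ Finset.range N, |y m (π x) - y m x| ≤ ε ∧
      ∀ p, absTail y N p ≤ ε → (x ≤ p → π x ≤ p) ∧ (p ≤ x → p ≤ π x) := by
  have hN : (0 : ℝ) < N + 1 := by positivity
  -- The sup metric on `Fin N → ℝ` handles all `N` functions at once; dividing by `N + 1` covers `N
  -- = 0`.
  obtain ⟨F, hF, hosc⟩ := exists_finset_Icc_cover (h := fun x (m : Fin N) => y m x)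
    (by fun_prop) (div_pos hε hN)
  choose k hk using fun p : K × K => exists_nearby_small_absTail_on_Icc hs p.1 p.2 N hε
  have key : ∀ x, ∃ z, absTail y N z ≤ ∑ m ∈ Finset.range (F.sup k), |y (m + N) x| + 2 * ε ∧
      ∑ m ∈ Finset.range N, |y m z - y m x| ≤ ε ∧
      ∀ p, absTail y N p ≤ ε → (x ≤ p → z ≤ p) ∧ (p ≤ x → p ≤ z) := by
    intro x
    obtain ⟨p, hp, hx⟩ := hF x
    obtain ⟨z, hz, hzt, hzo⟩ := hk p x hx
    refine ⟨z, hzt.trans ?_, ?_, hzo⟩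
    · gcongr
      exact Finset.le_sup hp
    · have hd := hosc p hp z hz x hx
      have hm : ∀ m ∈ Finset.range N, |y m z - y m x| ≤ ε / (N + 1) := fun m hm =>
        (dist_le_pi_dist (fun m : Fin N => y m z) (fun m : Fin N => y m x)
          ⟨m, Finset.mem_range.1 hm⟩).trans hd
      refine (Finset.sum_le_sum hm).trans ?_
      rw [Finset.sum_const, Finset.card_range, nsmul_eq_mul, mul_div_assoc', div_le_iff₀ hN]
      nlinarith
  choose π hπ using key
  exact ⟨F.sup k, π, hπ⟩

end CompactLine

/-- There are scales `N 0 < N 1 < ⋯` and maps that change the functions below a scale hardly at all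
and make the functions above it small up to what lies between this scale and the next. -/
theorem exists_scales {K : Type*} [LinearOrder K] [TopologicalSpace K] [OrderTopology K]
    [CompactSpace K] {y : ℕ → C(K, ℝ)} (hs : ∀ x, Summable fun m => |y m x|) {ε : ℝ} (hε : 0 < ε) :
    ∃ N : ℕ → ℕ, StrictMono N ∧ ∃ π : ℕ → K → K, ∀ i x,
      absTail y (N i) (π i x) ≤ ∑ m ∈ Finset.Ico (N i) (N (i + 1)), |y m x| + 2 * ε ∧
      ∑ m ∈ Finset.range (N i), |y m (π i x) - y m x| ≤ ε ∧
      ∀ p, absTail y (N i) p ≤ ε → (x ≤ p → π i x ≤ p) ∧ (p ≤ x → p ≤ π i x) := by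
  choose k π hπ using fun N => exists_map_small_absTail hs N hε
  -- The extra `1` makes `N` strictly increasing even where `k` is zero; it only adds a nonnegative
  -- term to the block.
  let N : ℕ → ℕ := fun i => Nat.rec 0 (fun _ n => n + (k n + 1)) i
  have hN : ∀ i, N (i + 1) = N i + (k (N i) + 1) := fun i => rfl
  refine ⟨N, strictMono_nat_of_lt_succ fun i => by rw [hN]; omega, fun i => π (N i),
    fun i x => ⟨(hπ (N i) x).1.trans ?_, (hπ (N i) x).2⟩⟩
  rw [hN, Finset.sum_Ico_eq_sum_range, Nat.add_sub_cancel_left, Finset.sum_range_succ]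
  have := abs_nonneg (y (N i + k (N i)) x)
  simp only [add_comm _ (N i)]
  linarith

/-! ### The space `c₀`, its basis and its functionals. -/

namespace ZeroAtInftyContinuousMap

theorem norm_le_iff_forall_abs {f : C₀(ℕ, ℝ)} {c : ℝ} (hc : 0 ≤ c) : ‖f‖ ≤ c ↔ ∀ n, |f n| ≤ c := by
  rw [← norm_toBCF_eq_norm, BoundedContinuousFunction.norm_le hc]
  rfl

theorem abs_apply_le_norm (f : C₀(ℕ, ℝ)) (n : ℕ) : |f n| ≤ ‖f‖ :=
  (norm_le_iff_forall_abs (norm_nonneg f)).1 le_rfl n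

/-- A real sequence converging to zero as an element of `C₀(ℕ, ℝ)`. -/
def ofTendsto (u : ℕ → ℝ) (hu : Tendsto u atTop (𝓝 0)) : C₀(ℕ, ℝ) where
  toFun := u
  continuous_toFun := continuous_of_discreteTopology
  zero_at_infty' := by rwa [cocompact_eq_atTop]

@[simp] theorem ofTendsto_apply (u : ℕ → ℝ) (hu : Tendsto u atTop (𝓝 0)) (n : ℕ) :
    ofTendsto u hu n = u n := rfl

theorem tendsto_atTop (f : C₀(ℕ, ℝ)) : Tendsto f atTop (𝓝 0) := by
  have := f.zero_at_infty'
  rwa [cocompact_eq_atTop] at this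

/-- The canonical basis of `C₀(ℕ, ℝ)`. -/
noncomputable def unitVector (m : ℕ) : C₀(ℕ, ℝ) :=
  ofTendsto (Pi.single m 1) (tendsto_const_nhds.congr' (by
    filter_upwards [eventually_gt_atTop m] with n hn
    simp [hn.ne']))

theorem unitVector_apply (m n : ℕ) : unitVector m n = if n = m then 1 else 0 := by
  simp [unitVector, Pi.single_apply]

/-- Evaluation at `n` as a continuous linear functional. -/
noncomputable def coordinate (n : ℕ) : C₀(ℕ, ℝ) →L[ℝ] ℝ :=
  LinearMap.mkContinuous ⟨⟨fun f => f n, fun _ _ => rfl⟩, fun _ _ => rfl⟩ 1 fun f => by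
    simpa using abs_apply_le_norm f n

@[simp] theorem coordinate_apply (n : ℕ) (f : C₀(ℕ, ℝ)) : coordinate n f = f n := rfl

theorem norm_coordinate_le (n : ℕ) : ‖coordinate n‖ ≤ 1 :=
  LinearMap.mkContinuous_norm_le _ zero_le_one _

theorem finset_sum_apply (s : Finset ℕ) (g : ℕ → C₀(ℕ, ℝ)) (n : ℕ) :
    (∑ m ∈ s, g m) n = ∑ m ∈ s, g m n := by
  simp only [← coordinate_apply, map_sum]

theorem sum_smul_unitVector_apply (s : Finset ℕ) (u : ℕ → ℝ) (n : ℕ) :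
    (∑ m ∈ s, u m • unitVector m) n = if n ∈ s then u n else 0 := by
  simp [finset_sum_apply, unitVector_apply]

/-- Test `ψ` on the vector of signs of its values, which has norm at most one. -/
theorem sum_abs_apply_unitVector_le (ψ : C₀(ℕ, ℝ) →L[ℝ] ℝ) (s : Finset ℕ) :
    ∑ m ∈ s, |ψ (unitVector m)| ≤ ‖ψ‖ := by
  set g : C₀(ℕ, ℝ) := ∑ m ∈ s, (SignType.sign (ψ (unitVector m)) : ℝ) • unitVector m with hg
  have hgn : ‖g‖ ≤ 1 := by
    refine (norm_le_iff_forall_abs zero_le_one).2 fun n => ?_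
    rw [hg, sum_smul_unitVector_apply]
    split_ifs
    · rcases SignType.sign (ψ (unitVector n)) with _ | _ | _ <;> simp
    · simp
  have h1 : ψ g = ∑ m ∈ s, |ψ (unitVector m)| := by
    simp [hg, map_sum, sign_mul_self]
  rw [← h1]
  calc ψ g ≤ ‖ψ g‖ := le_abs_self _
    _ ≤ ‖ψ‖ * ‖g‖ := ψ.le_opNorm g
    _ ≤ ‖ψ‖ := mul_le_of_le_one_right ψ.opNorm_nonneg hgn

theorem summable_abs_apply_unitVector (ψ : C₀(ℕ, ℝ) →L[ℝ] ℝ) :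
    Summable fun m => |ψ (unitVector m)| :=
  summable_of_sum_le (fun _ => abs_nonneg _) (sum_abs_apply_unitVector_le ψ)

theorem hasSum_smul_unitVector (a : C₀(ℕ, ℝ)) : HasSum (fun m => a m • unitVector m) a := by
  refine Metric.tendsto_nhds.2 fun ε hε => ?_
  have h := (Metric.tendsto_nhds.1 a.tendsto_atTop (ε / 2) (half_pos hε))
  obtain ⟨n₀, hn₀⟩ := eventually_atTop.1 h
  filter_upwards [eventually_ge_atTop (Finset.range n₀)] with s hs
  rw [dist_comm, dist_eq_norm]
  refine lt_of_le_of_lt ((norm_le_iff_forall_abs (half_pos hε).le).2 fun n => ?_) (half_lt_self hε)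
  rw [sub_apply, sum_smul_unitVector_apply]
  split_ifs with hn
  · simpa using (half_pos hε).le
  · have : n₀ ≤ n := by
      by_contra hlt
      exact hn (hs (Finset.mem_range.2 (not_le.1 hlt)))
    simpa [Real.dist_eq] using (hn₀ n this).le

theorem hasSum_mul_apply_unitVector (ψ : C₀(ℕ, ℝ) →L[ℝ] ℝ) (a : C₀(ℕ, ℝ)) :
    HasSum (fun m => a m * ψ (unitVector m)) (ψ a) := by
  simpa using (hasSum_smul_unitVector a).mapL ψ

/-- The values of two functionals differ little if one is close to the other on the first unit
vectors and small on the remaining ones. -/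
theorem abs_apply_sub_sum_range_le (ψ : C₀(ℕ, ℝ) →L[ℝ] ℝ) (a : C₀(ℕ, ℝ)) (N : ℕ) (v : ℕ → ℝ) :
    |ψ a - ∑ m ∈ Finset.range N, a m * v m| ≤
      ‖a‖ * (∑ m ∈ Finset.range N, |ψ (unitVector m) - v m| + ∑' m, |ψ (unitVector (m + N))|) := by
  have hsum := hasSum_mul_apply_unitVector ψ a
  have htail : Summable fun m => |ψ (unitVector (m + N))| :=
    (summable_nat_add_iff (f := fun m => |ψ (unitVector m)|) N).2 (summable_abs_apply_unitVector ψ)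
  have hle : ∀ m, ‖a (m + N) * ψ (unitVector (m + N))‖ ≤ ‖a‖ * |ψ (unitVector (m + N))| := by
    intro m
    rw [norm_mul]
    exact mul_le_mul_of_nonneg_right (abs_apply_le_norm a _) (abs_nonneg _)
  have h2 : |∑' m, a (m + N) * ψ (unitVector (m + N))| ≤ ‖a‖ * ∑' m, |ψ (unitVector (m + N))| := by
    rw [← tsum_mul_left]
    exact tsum_of_norm_bounded (htail.mul_left ‖a‖).hasSum hle
  have h1 : |∑ m ∈ Finset.range N, a m * (ψ (unitVector m) - v m)| ≤
      ‖a‖ * ∑ m ∈ Finset.range N, |ψ (unitVector m) - v m| := by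
    rw [Finset.mul_sum]
    refine (Finset.abs_sum_le_sum_abs _ _).trans (Finset.sum_le_sum fun m _ => ?_)
    rw [abs_mul]
    exact mul_le_mul_of_nonneg_right (abs_apply_le_norm a _) (abs_nonneg _)
  have h3 : ψ a - ∑ m ∈ Finset.range N, a m * v m =
      ∑ m ∈ Finset.range N, a m * (ψ (unitVector m) - v m) +
        ∑' m, a (m + N) * ψ (unitVector (m + N)) := by
    rw [← hsum.tsum_eq, ← hsum.summable.sum_add_tsum_nat_add N]
    simp only [mul_sub, Finset.sum_sub_distrib]
    ring
  rw [h3, mul_add]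
  exact (abs_add_le _ _).trans (add_le_add h1 h2)

end ZeroAtInftyContinuousMap

/-! ### Bounded functions, extension of functionals and a complementation criterion. -/

/-- Composition with an arbitrary map `π : D → K`, from continuous functions on a compact space to
bounded functions. -/
noncomputable def boundedComp {K D : Type*} [TopologicalSpace K] [CompactSpace K] (π : D → K) :
    C(K, ℝ) →L[ℝ] lp (fun _ : D => ℝ) ⊤ :=
  LinearMap.mkContinuous
    { toFun := fun f => ⟨fun x => f (π x), memℓp_infty ⟨‖f‖, by
        rintro _ ⟨x, rfl⟩
        exact f.norm_coe_le_norm (π x)⟩⟩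
      map_add' := fun _ _ => rfl
      map_smul' := fun _ _ => rfl } 1 fun f => by
    rw [one_mul]
    exact lp.norm_le_of_forall_le (norm_nonneg f) fun x => f.norm_coe_le_norm (π x)

@[simp] theorem boundedComp_apply {K D : Type*} [TopologicalSpace K] [CompactSpace K] (π : D → K)
    (f : C(K, ℝ)) (x : D) : boundedComp π f x = f (π x) := rfl

theorem norm_boundedComp_le {K D : Type*} [TopologicalSpace K] [CompactSpace K] (π : D → K)
    (f : C(K, ℝ)) : ‖boundedComp π f‖ ≤ ‖f‖ :=
  lp.norm_le_of_forall_le (norm_nonneg f) fun x => f.norm_coe_le_norm (π x)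

open ZeroAtInftyContinuousMap

/-- Hahn–Banach extension along a linear isometry. -/
theorem LinearIsometry.exists_dual_extension {E F : Type*} [NormedAddCommGroup E] [NormedSpace ℝ E]
    [NormedAddCommGroup F] [NormedSpace ℝ F] (j : E →ₗᵢ[ℝ] F) (g : E →L[ℝ] ℝ) :
    ∃ μ : F →L[ℝ] ℝ, (∀ x, μ (j x) = g x) ∧ ‖μ‖ ≤ ‖g‖ := by
  obtain ⟨μ, hμ, hnorm⟩ := exists_extension_norm_eq (𝕜 := ℝ) j.toLinearMap.range
    (g ∘L (j.equivRange.symm.toContinuousLinearEquiv : _ →L[ℝ] E))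
  refine ⟨μ, fun x => ?_, ?_⟩
  · have h := hμ (j.equivRange x)
    simpa using h
  · rw [hnorm]
    refine ContinuousLinearMap.opNorm_le_bound _ g.opNorm_nonneg fun z => ?_
    refine (g.le_opNorm _).trans_eq ?_
    congr 1
    exact j.equivRange.symm.norm_map z

/-- A bounded sequence of functionals tending to zero pointwise defines an operator into `c₀`. -/
theorem exists_toZeroAtInfty {E : Type*} [NormedAddCommGroup E] [NormedSpace ℝ E]
    (ν : ℕ → E →L[ℝ] ℝ) {M : ℝ} (hM : 0 ≤ M) (hν : ∀ n x, |ν n x| ≤ M * ‖x‖)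
    (h0 : ∀ x, Tendsto (fun n => ν n x) atTop (𝓝 0)) :
    ∃ P : E →L[ℝ] C₀(ℕ, ℝ), ∀ x n, P x n = ν n x :=
  ⟨LinearMap.mkContinuous
    { toFun := fun x => ofTendsto (fun n => ν n x) (h0 x)
      map_add' := fun x y => by ext n; simp
      map_smul' := fun c x => by ext n; simp } M fun x =>
        (norm_le_iff_forall_abs (by positivity)).2 fun n => hν n x, fun _ _ => rfl⟩

/-- A copy of `c₀` is complemented if an operator into `c₀` nearly inverts its embedding. -/
theorem closedComplemented_of_nearly_inverse {X : Type*} [NormedAddCommGroup X] [NormedSpace ℝ X]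
    {Y : Submodule ℝ X} (e : C₀(ℕ, ℝ) ≃L[ℝ] Y) (P : X →L[ℝ] C₀(ℕ, ℝ))
    (hP : ∀ a, ‖P (e a) - a‖ ≤ 1 / 2 * ‖a‖) : Y.ClosedComplemented := by
  set S : C₀(ℕ, ℝ) →L[ℝ] C₀(ℕ, ℝ) := P ∘L Y.subtypeL ∘L (e : C₀(ℕ, ℝ) →L[ℝ] Y) with hS
  have hlt : ‖1 - S‖ < 1 := by
    refine (ContinuousLinearMap.opNorm_le_bound _ (by norm_num : (0 : ℝ) ≤ 1 / 2)
      fun a => ?_).trans_lt (by norm_num)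
    rw [← norm_neg]
    simpa [hS] using hP a
  obtain ⟨u, hu⟩ : IsUnit S := by
    have := isUnit_one_sub_of_norm_lt_one (x := 1 - S) hlt
    convert this using 1
    exact (sub_sub_cancel 1 S).symm
  -- With `S` the restriction of `P` to the copy, invertible by the Neumann series, the projection
  -- is `e ∘ S⁻¹ ∘ P`.
  refine ⟨(e : C₀(ℕ, ℝ) →L[ℝ] Y) ∘L (↑u⁻¹ : C₀(ℕ, ℝ) →L[ℝ] C₀(ℕ, ℝ)) ∘L P, fun z => ?_⟩
  obtain ⟨a, rfl⟩ := e.surjective z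
  have h1 : (↑u⁻¹ : C₀(ℕ, ℝ) →L[ℝ] C₀(ℕ, ℝ)) (S a) = a := by
    rw [← hu, ← mul_apply_eq_comp, Units.inv_mul, one_apply_eq_self]
  exact congrArg e h1

/-- A function tending to infinity that stays `r` steps behind the inverse of `N`. -/
theorem exists_tendsto_atTop_of_strictMono {N : ℕ → ℕ} (hN : StrictMono N) (r : ℕ) :
    ∃ s : ℕ → ℕ, Tendsto s atTop atTop ∧ ∀ n, N r ≤ n → N (s n + r) ≤ n := by
  classical
  -- The default value `0` of the search also satisfies the predicate, because `N r ≤ n`.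
  refine ⟨fun n => Nat.findGreatest (fun s => N (s + r) ≤ n) n, tendsto_atTop.2 fun b => ?_,
    fun n hn => Nat.findGreatest_spec (P := fun s => N (s + r) ≤ n) (Nat.zero_le n)
      (by simpa using hn)⟩
  filter_upwards [eventually_ge_atTop (N (b + r))] with n hn
  exact Nat.le_findGreatest ((Nat.le_add_right b r).trans ((hN.id_le _).trans hn)) hn

theorem lp.smul_apply_real {D : Type*} (c : ℝ) (g : lp (fun _ : D => ℝ) ⊤) (x : D) :
    (c • g) x = c * g x := rfl

theorem lp.sum_apply_real {D ι : Type*} (F : Finset ι) (g : ι → lp (fun _ : D => ℝ) ⊤) (x : D) :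
    (∑ i ∈ F, g i) x = ∑ i ∈ F, g i x :=
  map_sum (lp.evalₗ (𝕜 := ℝ) (fun _ : D => ℝ) ⊤ x) g F

/-! ### Averages of compositions. -/

section Averages

variable {K : Type*} [TopologicalSpace K] [CompactSpace K]

/-- The mean over `r` consecutive indices, from `s` on, of composition with the maps `π i`. -/
noncomputable def averageComp (π : ℕ → K → K) (r s : ℕ) : C(K, ℝ) →L[ℝ] lp (fun _ : K => ℝ) ⊤ :=
  (r : ℝ)⁻¹ • ∑ i ∈ Finset.range r, boundedComp (π (s + i))

theorem averageComp_apply (π : ℕ → K → K) (r s : ℕ) (f : C(K, ℝ)) (x : K) :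
    averageComp π r s f x = (r : ℝ)⁻¹ * ∑ i ∈ Finset.range r, f (π (s + i) x) := by
  rw [averageComp, _root_.smul_apply, sum_apply, lp.smul_apply_real, lp.sum_apply_real]
  rfl

theorem norm_averageComp_le (π : ℕ → K → K) (r s : ℕ) (f : C(K, ℝ)) :
    ‖averageComp π r s f‖ ≤ ‖f‖ := by
  refine lp.norm_le_of_forall_le (norm_nonneg f) fun x => ?_
  rw [averageComp_apply, norm_mul, norm_inv, Real.norm_natCast]
  rcases r.eq_zero_or_pos with rfl | hr
  · simp
  rw [inv_mul_le_iff₀ (by exact_mod_cast hr)]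
  refine (norm_sum_le_of_le _ fun i _ => f.norm_coe_le_norm (π (s + i) x)).trans ?_
  simp

theorem norm_averageComp_sub_le (π : ℕ → K → K) {r : ℕ} (hr : 0 < r) (s : ℕ) (f : C(K, ℝ)) {δ : ℝ}
    (hδ : 0 ≤ δ) (h : ∀ i, s ≤ i → ∀ x, |f (π i x) - f x| ≤ δ) :
    ‖averageComp π r s f - boundedComp id f‖ ≤ δ := by
  have hr' : (0 : ℝ) < r := by exact_mod_cast hr
  refine lp.norm_le_of_forall_le hδ fun x => ?_
  have : (averageComp π r s f - boundedComp id f) x =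
      (r : ℝ)⁻¹ * ∑ i ∈ Finset.range r, (f (π (s + i) x) - f x) := by
    rw [lp.coeFn_sub, Pi.sub_apply, averageComp_apply, Finset.sum_sub_distrib]
    simp [mul_sub, hr'.ne']
  rw [this, norm_mul, norm_inv, Real.norm_natCast, inv_mul_le_iff₀ hr']
  refine (norm_sum_le_of_le _ fun i _ => h (s + i) (Nat.le_add_right s i) x).trans ?_
  simp

end Averages

/-! ### Averages on the range of an operator from `c₀`. -/

section EvalComp

variable {K : Type*} [TopologicalSpace K]

/-- The functional `a ↦ T a x`. -/
noncomputable def evalComp (T : C₀(ℕ, ℝ) →L[ℝ] C(K, ℝ)) (x : K) : C₀(ℕ, ℝ) →L[ℝ] ℝ :=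
  ContinuousMap.evalCLM ℝ x ∘L T

@[simp] theorem evalComp_apply (T : C₀(ℕ, ℝ) →L[ℝ] C(K, ℝ)) (x : K) (a : C₀(ℕ, ℝ)) :
    evalComp T x a = T a x := rfl

variable [CompactSpace K]

theorem norm_evalComp_le (T : C₀(ℕ, ℝ) →L[ℝ] C(K, ℝ)) (x : K) : ‖evalComp T x‖ ≤ ‖T‖ :=
  ContinuousLinearMap.opNorm_le_bound _ T.opNorm_nonneg fun a =>
    ((T a).norm_coe_le_norm x).trans (T.le_opNorm a)

/-- For an operator `T` from `c₀`, the average of `r` consecutive compositions with the maps of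
`exists_scales` takes `T a` close to a combination of the `T eₘ` with small `m`. -/
theorem norm_averageComp_sub_sum_le (T : C₀(ℕ, ℝ) →L[ℝ] C(K, ℝ)) {N : ℕ → ℕ} (hN : StrictMono N)
    {π : ℕ → K → K} {ε : ℝ} (hε : 0 < ε)
    (h : ∀ i x, absTail (fun m => T (unitVector m)) (N i) (π i x) ≤
        ∑ m ∈ Finset.Ico (N i) (N (i + 1)), |T (unitVector m) x| + 2 * ε ∧
      ∑ m ∈ Finset.range (N i), |T (unitVector m) (π i x) - T (unitVector m) x| ≤ ε)
    {r : ℕ} (hr : 0 < r) (s : ℕ) (a : C₀(ℕ, ℝ)) :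
    ‖averageComp π r s (T a) - (r : ℝ)⁻¹ • ∑ i ∈ Finset.range r, ∑ m ∈ Finset.range (N (s + i)),
      a m • boundedComp id (T (unitVector m))‖ ≤ ‖a‖ * (‖T‖ / r + 3 * ε) := by
  have hr' : (0 : ℝ) < r := by exact_mod_cast hr
  have hT := T.opNorm_nonneg
  refine lp.norm_le_of_forall_le (by positivity) fun x => ?_
  have hx : (averageComp π r s (T a) - (r : ℝ)⁻¹ • ∑ i ∈ Finset.range r,
      ∑ m ∈ Finset.range (N (s + i)), a m • boundedComp id (T (unitVector m))) x =
      (r : ℝ)⁻¹ * ∑ i ∈ Finset.range r, (T a (π (s + i) x) -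
        ∑ m ∈ Finset.range (N (s + i)), a m * T (unitVector m) x) := by
    rw [lp.coeFn_sub, Pi.sub_apply, averageComp_apply, Finset.sum_sub_distrib]
    simp only [lp.smul_apply_real, lp.sum_apply_real, boundedComp_apply, id, mul_sub]
  have hi : ∀ i ∈ Finset.range r, ‖T a (π (s + i) x) -
        ∑ m ∈ Finset.range (N (s + i)), a m * T (unitVector m) x‖ ≤
      ‖a‖ * (∑ m ∈ Finset.Ico (N (s + i)) (N (s + (i + 1))), |T (unitVector m) x| + 3 * ε) := by
    intro i _
    refine (abs_apply_sub_sum_range_le (evalComp T (π (s + i) x)) a (N (s + i))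
      (fun m => T (unitVector m) x)).trans (mul_le_mul_of_nonneg_left ?_ (norm_nonneg a))
    have h1 := (h (s + i) x).1
    have h2 := (h (s + i) x).2
    rw [absTail] at h1
    simp only [evalComp_apply]
    rw [← add_assoc s i 1]
    linarith
  -- The consecutive blocks join into one, so their total has a bound independent of `r`; division
  -- by `r` then makes it small.
  have hsum : ∑ i ∈ Finset.range r,
      ∑ m ∈ Finset.Ico (N (s + i)) (N (s + (i + 1))), |T (unitVector m) x| ≤ ‖T‖ := by
    have hI : ∀ k, ∑ i ∈ Finset.range k,
        ∑ m ∈ Finset.Ico (N (s + i)) (N (s + (i + 1))), |T (unitVector m) x| =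
        ∑ m ∈ Finset.Ico (N s) (N (s + k)), |T (unitVector m) x| := by
      intro k
      induction k with
      | zero => simp
      | succ k ih =>
        rw [Finset.sum_range_succ, ih]
        exact Finset.sum_Ico_consecutive _ (hN.monotone (Nat.le_add_right s k))
          (hN.monotone (by omega))
    rw [hI]
    exact (sum_abs_apply_unitVector_le (evalComp T x) _).trans (norm_evalComp_le T x)
  rw [hx, norm_mul, norm_inv, Real.norm_natCast, inv_mul_le_iff₀ hr']
  refine (norm_sum_le_of_le _ hi).trans ?_
  rw [← Finset.mul_sum, Finset.sum_add_distrib]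
  simp only [Finset.sum_const, Finset.card_range, nsmul_eq_mul]
  have : (r : ℝ) * (‖a‖ * (‖T‖ / r + 3 * ε)) = ‖a‖ * (‖T‖ + r * (3 * ε)) := by
    field_simp
  rw [this]
  gcongr

end EvalComp

/-! ### Assembling the projection. -/

theorem corollary2p4 (K : Type*) [LinearOrder K] [TopologicalSpace K] [OrderTopology K]
    [CompactSpace K] : HasSobczykProperty C(K, ℝ) := by
  rintro Y ⟨e⟩
  set T : C₀(ℕ, ℝ) →L[ℝ] C(K, ℝ) := Y.subtypeL ∘L (e : C₀(ℕ, ℝ) →L[ℝ] Y) with hT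
  -- The `+ 1` in `M` below makes it positive, as it is used as a divisor.
  have hTn := T.opNorm_nonneg
  have hTe : ∀ a, T a = e a := fun _ => rfl
  set M : ℝ := ‖(e.symm : Y →L[ℝ] C₀(ℕ, ℝ))‖ + 1 with hM
  have hM0 : 0 < M := by
    have := (e.symm : Y →L[ℝ] C₀(ℕ, ℝ)).opNorm_nonneg
    linarith
  let ι : C(K, ℝ) →ₗᵢ[ℝ] lp (fun _ : K => ℝ) ⊤ :=
    { (boundedComp (K := K) id).toLinearMap with
      norm_map' := fun f => le_antisymm (norm_boundedComp_le id f)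
        ((ContinuousMap.norm_le f (norm_nonneg _)).2 fun x =>
          lp.norm_apply_le_norm ENNReal.top_ne_zero (boundedComp id f) x) }
  have hμ : ∀ n, ∃ μ : lp (fun _ : K => ℝ) ⊤ →L[ℝ] ℝ,
      (∀ a, μ (boundedComp id (T a)) = a n) ∧ ∀ g, |μ g| ≤ M * ‖g‖ := by
    intro n
    obtain ⟨μ, hμ, hμn⟩ := (ι.comp Y.subtypeₗᵢ).exists_dual_extension
      (coordinate n ∘L (e.symm : Y →L[ℝ] C₀(ℕ, ℝ)))
    refine ⟨μ, fun a => ?_, fun g => (μ.le_opNorm g).trans ?_⟩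
    · exact (hμ (e a)).trans (by simp)
    · refine mul_le_mul_of_nonneg_right (hμn.trans ?_) (norm_nonneg g)
      refine (ContinuousLinearMap.opNorm_comp_le _ _).trans ?_
      have h1 := norm_coordinate_le n
      have h2 := (e.symm : Y →L[ℝ] C₀(ℕ, ℝ)).opNorm_nonneg
      nlinarith
  choose μ hμe hμn using hμ
  have hs : ∀ x, Summable fun m => |T (unitVector m) x| := fun x =>
    summable_abs_apply_unitVector (evalComp T x)
  -- The choices of `ε` and `r` make each of `M * (3 * ε)` and `M * (‖T‖ / r)` at most `1 / 4`.
  set ε : ℝ := 1 / (12 * M) with hε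
  have hε0 : 0 < ε := by positivity
  obtain ⟨r, hr⟩ := exists_nat_gt (4 * M * ‖T‖)
  have hr' : (0 : ℝ) < r := lt_of_le_of_lt (by positivity) hr
  have hr0 : 0 < r := by exact_mod_cast hr'
  obtain ⟨N, hN, π, hπ⟩ := exists_scales hs hε0
  obtain ⟨s, hs_top, hsN⟩ := exists_tendsto_atTop_of_strictMono hN r
  have hconst : M * (‖T‖ / r + 3 * ε) ≤ 1 / 2 := by
    have h1 : M * (3 * ε) = 1 / 4 := by rw [hε]; field_simp; norm_num
    have h2 : M * (‖T‖ / r) ≤ 1 / 4 := by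
      rw [mul_div_assoc', div_le_iff₀ hr']
      linarith
    linarith
  -- For the finitely many `n < N r` there is no room for `r` scales below `n`; taking `A n = 0`
  -- there makes the coordinate exact on the copy and does not affect limits.
  let A : ℕ → C(K, ℝ) →L[ℝ] lp (fun _ : K => ℝ) ⊤ := fun n =>
    if N r ≤ n then averageComp π r (s n) else 0
  have hA : ∀ n f, ‖A n f‖ ≤ ‖f‖ := by
    intro n f
    simp only [A]
    split_ifs
    · exact norm_averageComp_le π r (s n) f
    · simp
  have hπu : ∀ p, ∀ᶠ i in atTop, ∀ x, (x ≤ p → π i x ≤ p) ∧ (p ≤ x → p ≤ π i x) := by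
    intro p
    have := ((tendsto_absTail (y := fun m => T (unitVector m)) p).comp
      hN.tendsto_atTop).eventually_le_const hε0
    filter_upwards [this] with i hi x
    exact (hπ i x).2.2 p hi
  obtain ⟨P, hP⟩ := exists_toZeroAtInfty
    (fun n => μ n ∘L (boundedComp id - A n)) (M := M * 2) (by positivity)
    (fun n f => by
      refine (hμn n _).trans ?_
      rw [mul_assoc]
      refine mul_le_mul_of_nonneg_left ?_ hM0.le
      exact ((norm_sub_le _ _).trans (add_le_add (norm_boundedComp_le id f) (hA n f))).trans_eq
        (two_mul _).symm)
    (fun f => by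
      refine Metric.tendsto_nhds.2 fun δ hδ => ?_
      have hδ' : 0 < δ / (2 * M) := by positivity
      obtain ⟨i₀, hi₀⟩ := eventually_atTop.1 (eventually_forall_abs_comp_sub_le hπu f hδ')
      filter_upwards [hs_top.eventually_ge_atTop i₀, eventually_ge_atTop (N r)] with n hn hnr
      rw [dist_zero_right]
      refine (hμn n _).trans_lt ?_
      have hb := norm_averageComp_sub_le π hr0 (s n) f hδ'.le fun i hi => hi₀ i (hn.trans hi)
      have hAn : A n = averageComp π r (s n) := if_pos hnr
      change M * ‖boundedComp id f - A n f‖ < δ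
      rw [norm_sub_rev, hAn]
      calc M * _ ≤ M * (δ / (2 * M)) := mul_le_mul_of_nonneg_left hb hM0.le
        _ = δ / 2 := by field_simp
        _ < δ := half_lt_self hδ)
  refine closedComplemented_of_nearly_inverse e P fun a => ?_
  refine (norm_le_iff_forall_abs (by positivity)).2 fun n => ?_
  have hPn : (P (e a) - a) n = - μ n (A n (T a)) := by
    rw [ZeroAtInftyContinuousMap.sub_apply, hP, ← hTe]
    simp [hμe]
  rw [hPn, abs_neg]
  by_cases hn : N r ≤ n
  swap
  · have hAn : A n = 0 := if_neg hn
    simp [hAn]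
  have hAn : A n = averageComp π r (s n) := if_pos hn
  set H := (r : ℝ)⁻¹ • ∑ i ∈ Finset.range r, ∑ m ∈ Finset.range (N (s n + i)),
      a m • boundedComp (id : K → K) (T (unitVector m)) with hH
  -- Every index in `H` is below `N (s n + r) ≤ n`, and `μ n` vanishes on `T eₘ` for `m ≠ n`.
  have hμH : μ n H = 0 := by
    simp only [hH, map_smul, map_sum, hμe, unitVector_apply]
    refine smul_eq_zero_of_right _ (Finset.sum_eq_zero fun i hi => Finset.sum_eq_zero fun m hm => ?_)
    have h1 : N (s n + i) ≤ N (s n + r) :=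
      hN.monotone (Nat.add_le_add_left (Finset.mem_range.1 hi).le _)
    have h2 := Finset.mem_range.1 hm
    have h3 := hsN n hn
    rw [if_neg (by omega), smul_zero]
  have hmain := norm_averageComp_sub_sum_le T hN hε0
    (fun i x => ⟨(hπ i x).1, (hπ i x).2.1⟩) hr0 (s n) a
  have : μ n (A n (T a)) = μ n (averageComp π r (s n) (T a) - H) := by
    rw [map_sub, hμH, sub_zero, hAn]
  rw [this]
  calc _ ≤ M * (‖a‖ * (‖T‖ / r + 3 * ε)) :=
        (hμn n _).trans (mul_le_mul_of_nonneg_left hmain hM0.le)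
    _ = M * (‖T‖ / r + 3 * ε) * ‖a‖ := by ring
    _ ≤ 1 / 2 * ‖a‖ := mul_le_mul_of_nonneg_right hconst (norm_nonneg a)
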